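/- Let $X$ be an infinite compact Hausdorff space and let $\tau$ be its weight, that is, the least cardinality of a base of its topology. Let $F(X)$ (respectively $A(X)$) be the Markov free topological group (respectively free abelian topological group) over $X$, that is, the free group (respectively free abelian group) on the set $X$ with the finest group topology for which the canonical map from $X$ is continuous. For a topological group $G$ with identity $e$, let $\mathcal N_e(G)$ be the set of all neighbourhoods of $e$, ordered by reverse inclusion. Let $[\tau]^{<\omega}$ be the set of all finite subsets of $\tau$ ordered by inclusion, and let $([\tau]^{<\omega})^\omega$ be the set of all sequences of such subsets with the coordinatewise order. For directed preordered sets $P,Q$, write $P\le_T Q$ if there is a map $Q\to P$ that sends every cofinal subset of $Q$ to a cofinal subset of $P$, and write $P=_T Q$ if $P\le_T Q$ and $Q\le_T P$. Then $$\mathcal N_e(F(X)) =_T \mathcal N_e(A(X)) =_T ([\tau]^{<\omega})^\omega .$$ -/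

import Mathlib

open Cardinal Topology

universe u v

/-- `P ≤_T Q`: there is a cofinal map `Q → P`, i.e. a map sending every cofinal subset of `Q` to a
cofinal subset of `P`. -/
def TukeyLE (P : Type u) (Q : Type v) [Preorder P] [Preorder Q] : Prop :=
  ∃ φ : Q → P, ∀ C : Set Q, IsCofinal C → IsCofinal (φ '' C)

/-- `P =_T Q`. -/
def TukeyEquiv (P : Type u) (Q : Type v) [Preorder P] [Preorder Q] : Prop :=
  TukeyLE P Q ∧ TukeyLE Q P

/-- The neighbourhood filter of `G` at `e`, ordered by reverse inclusion. -/
abbrev NhdsPoset (G : Type u) [TopologicalSpace G] (e : G) : Type u :=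
  {U : Set G // U ∈ 𝓝 e}ᵒᵈ

/-- The weight of a topological space: the least cardinality of a base. -/
noncomputable def topWeight (X : Type u) [TopologicalSpace X] : Cardinal.{u} :=
  sInf {c | ∃ B : Set (Set X), TopologicalSpace.IsTopologicalBasis B ∧ #B = c}

/-- The (Markov) free topological group `F(X)`: the free group on `X` with the finest group
topology for which the canonical map from `X` is continuous. -/
def FreeTopGroup (X : Type u) : Type u := FreeGroup X

instance (X : Type u) : Group (FreeTopGroup X) := inferInstanceAs (Group (FreeGroup X))

/-- The canonical map `X → F(X)`. -/
def FreeTopGroup.of {X : Type u} : X → FreeTopGroup X := FreeGroup.of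

instance (X : Type u) [TopologicalSpace X] : TopologicalSpace (FreeTopGroup X) :=
  (GroupTopology.coinduced (FreeTopGroup.of : X → FreeTopGroup X)).toTopologicalSpace

instance (X : Type u) [TopologicalSpace X] : IsTopologicalGroup (FreeTopGroup X) :=
  (GroupTopology.coinduced (FreeTopGroup.of : X → FreeTopGroup X)).toIsTopologicalGroup

/-- The (Markov) free abelian topological group `A(X)`, written additively: the free abelian group
on `X` with the finest group topology for which the canonical map from `X` is continuous. -/
def FreeAbTopGroup (X : Type u) : Type u := FreeAbelianGroup X

instance (X : Type u) : AddCommGroup (FreeAbTopGroup X) :=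
  inferInstanceAs (AddCommGroup (FreeAbelianGroup X))

/-- The canonical map `X → A(X)`. -/
def FreeAbTopGroup.of {X : Type u} : X → FreeAbTopGroup X := FreeAbelianGroup.of

instance (X : Type u) [TopologicalSpace X] : TopologicalSpace (FreeAbTopGroup X) :=
  (AddGroupTopology.coinduced (FreeAbTopGroup.of : X → FreeAbTopGroup X)).toTopologicalSpace

instance (X : Type u) [TopologicalSpace X] : IsTopologicalAddGroup (FreeAbTopGroup X) :=
  (AddGroupTopology.coinduced (FreeAbTopGroup.of : X → FreeAbTopGroup X)).toIsTopologicalAddGroup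

/-! Only two properties of `F(X)` and `A(X)` matter: the group topology is the finest making the
canonical map `i` continuous, and maps from `X` into abelian groups extend to homomorphisms.

Upper bound: by compactness the neighbourhoods of the diagonal have an antitone base indexed by the
finite subsets of `τ` (`exists_antitone_entourages`). A sequence `E n` of them yields `basicNhd`:
products, in any order and with each `n` used at most once, of conjugates by words of length at most
`n` of elements `x y⁻¹` with `(x, y)` or `(y, x)` in `E n`. These sets define a group topology
making `i` continuous, so they are neighbourhoods of the identity; since the words of length at most
`n` form a compact set, they are also cofinal.

Lower bound: take `τ` functions in the unit ball of `C(X, ℝ)` at mutual distance at least `1/2`. For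
a sequence `F` of finite index sets, the map `x ↦ (2⁻ⁿ f_a(x))`, `a ∈ F n`, is continuous for the
uniform topology and extends to a homomorphism; let `O F` be the preimage of the open unit ball. A
neighbourhood `V` inside `O F` controls the oscillation of `f_a` for every `a ∈ F n`, and a total
boundedness argument confines such `a` to a finite set depending only on `V` and `n`. -/

theorem TukeyLE.of_galois {P : Type u} {Q : Type v} [Preorder P] [Preorder Q] (ψ : P → Q)
    (φ : Q → P) (h : ∀ p q, ψ p ≤ q → p ≤ φ q) : TukeyLE P Q := by
  refine ⟨φ, fun C hC p => ?_⟩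
  obtain ⟨c, hc, hpc⟩ := hC (ψ p)
  exact ⟨φ c, ⟨c, hc, rfl⟩, h p c hpc⟩

theorem TukeyLE.trans {P : Type*} {Q : Type*} {R : Type*} [Preorder P] [Preorder Q] [Preorder R]
    (h₁ : TukeyLE P Q) (h₂ : TukeyLE Q R) : TukeyLE P R := by
  obtain ⟨φ, hφ⟩ := h₁
  obtain ⟨χ, hχ⟩ := h₂
  refine ⟨φ ∘ χ, fun C hC => ?_⟩
  rw [Set.image_comp]
  exact hφ _ (hχ _ hC)

/-! ### Finest group topologies. -/

/-- The group `G` is generated by the image of `i`, and carries the finest group topology making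
`i` continuous. -/
structure IsFinestGroupTopology {X : Type*} {G : Type*} [TopologicalSpace X] [Group G]
    [tG : TopologicalSpace G] (i : X → G) : Prop where
  continuous : Continuous i
  closure_range : Subgroup.closure (Set.range i) = ⊤
  le : ∀ t : TopologicalSpace G, @IsTopologicalGroup G t _ → Continuous[_, t] i → tG ≤ t

/-- The topology induced by `f` is a group topology making `i` continuous, hence coarser than the
finest one. -/
theorem IsFinestGroupTopology.continuous_hom {X G H : Type*} [TopologicalSpace X] [Group G]
    [TopologicalSpace G] [Group H] [TopologicalSpace H] [IsTopologicalGroup H] {i : X → G}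
    (hi : IsFinestGroupTopology i) (f : G →* H) (hf : Continuous (f ∘ i)) : Continuous f :=
  continuous_iff_le_induced.2
    (hi.le _ (topologicalGroup_induced f) (continuous_induced_rng.2 hf))

theorem FreeTopGroup.isFinestGroupTopology (X : Type u) [TopologicalSpace X] :
    IsFinestGroupTopology (FreeTopGroup.of : X → FreeTopGroup X) where
  continuous := GroupTopology.coinduced_continuous _
  closure_range := FreeGroup.closure_range_of X
  le t ht hc := by
    have : GroupTopology.coinduced (FreeTopGroup.of : X → FreeTopGroup X) ≤ ⟨t, ht⟩ :=
      sInf_le (continuous_iff_coinduced_le.1 hc)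
    exact this

/-- The canonical map from `X` to `A(X)` written multiplicatively. -/
def FreeAbTopGroup.mulOf {X : Type u} (x : X) : Multiplicative (FreeAbTopGroup X) :=
  Multiplicative.ofAdd (FreeAbTopGroup.of x)

theorem FreeAbTopGroup.isFinestGroupTopology (X : Type u) [TopologicalSpace X] :
    IsFinestGroupTopology (FreeAbTopGroup.mulOf : X → Multiplicative (FreeAbTopGroup X)) where
  continuous := AddGroupTopology.coinduced_continuous (FreeAbTopGroup.of : X → FreeAbTopGroup X)
  closure_range := by
    refine eq_top_iff.2 fun a _ => ?_
    refine FreeAbelianGroup.induction_on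
      (motive := fun a : FreeAbelianGroup X => (Multiplicative.ofAdd (show FreeAbTopGroup X from a)) ∈
        Subgroup.closure (Set.range (FreeAbTopGroup.mulOf : X → _))) a.toAdd ?_ ?_ ?_ ?_
    · exact Subgroup.one_mem _
    · exact fun x => Subgroup.subset_closure ⟨x, rfl⟩
    · exact fun x hx => Subgroup.inv_mem _ hx
    · exact fun x y hx hy => Subgroup.mul_mem _ hx hy
  le t ht hc := by
    let t' : TopologicalSpace (FreeAbTopGroup X) := t
    have ht' : @IsTopologicalAddGroup (FreeAbTopGroup X) t' _ :=
      { continuous_add := ht.continuous_mul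
        continuous_neg := ht.continuous_inv }
    have : AddGroupTopology.coinduced (FreeAbTopGroup.of : X → FreeAbTopGroup X) ≤ ⟨t', ht'⟩ :=
      sInf_le (continuous_iff_coinduced_le.1 hc)
    exact this

/-! ### Unordered products along a sequence of sets. -/

/-- Products of finitely many elements of the sets `T n`, taken in any order, each `n` being used
at most once. -/
def permProd {G : Type*} [Monoid G] (T : ℕ → Set G) : Set G :=
  {g | ∃ (l : List ℕ) (t : ℕ → G), l.Nodup ∧ (∀ n ∈ l, t n ∈ T n) ∧ (l.map t).prod = g}

section permProd

variable {G : Type*} [Group G]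

theorem permProd_mono {T T' : ℕ → Set G} (h : ∀ n, T n ⊆ T' n) : permProd T ⊆ permProd T' := by
  rintro _ ⟨l, t, hl, ht, rfl⟩
  exact ⟨l, t, hl, fun n hn => h n (ht n hn), rfl⟩

theorem one_mem_permProd (T : ℕ → Set G) : (1 : G) ∈ permProd T :=
  ⟨[], fun _ => 1, List.nodup_nil, by simp, by simp⟩

theorem subset_permProd (T : ℕ → Set G) (n : ℕ) : T n ⊆ permProd T := fun g hg =>
  ⟨[n], fun _ => g, List.nodup_singleton n, by simpa using hg, by simp⟩

/-- Even indices serve the first factor and odd ones the second, so no index repeats. -/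
theorem permProd_mul_mem {T T' : ℕ → Set G} (h₀ : ∀ n, T' n ⊆ T (2 * n))
    (h₁ : ∀ n, T' n ⊆ T (2 * n + 1)) {a b : G} (ha : a ∈ permProd T') (hb : b ∈ permProd T') :
    a * b ∈ permProd T := by
  obtain ⟨l, t, hl, ht, rfl⟩ := ha
  obtain ⟨l', t', hl', ht', rfl⟩ := hb
  refine ⟨l.map (fun n => 2 * n) ++ l'.map (fun n => 2 * n + 1),
    fun m => if m % 2 = 0 then t (m / 2) else t' (m / 2), ?_, ?_, ?_⟩
  · refine List.Nodup.append (hl.map fun a b h => by simpa using h)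
      (hl'.map fun a b h => by simpa using h) ?_
    intro m hm hm'
    simp only [List.mem_map] at hm hm'
    obtain ⟨a, -, rfl⟩ := hm
    obtain ⟨b, -, hb⟩ := hm'
    omega
  · intro m hm
    rw [List.mem_append, List.mem_map, List.mem_map] at hm
    rcases hm with ⟨a, ha, rfl⟩ | ⟨a, ha, rfl⟩
    · simpa using h₀ _ (ht a ha)
    · have h2 : (2 * a + 1) / 2 = a := by omega
      simpa [Nat.add_mod, h2] using h₁ _ (ht' a ha)
  · have h2 (a : ℕ) : (2 * a + 1) / 2 = a := by omega
    simp [Function.comp_def, Nat.add_mod, h2]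

theorem permProd_inv_mem {T : ℕ → Set G} (h : ∀ n, ∀ g ∈ T n, g⁻¹ ∈ T n) {a : G}
    (ha : a ∈ permProd T) : a⁻¹ ∈ permProd T := by
  obtain ⟨l, t, hl, ht, rfl⟩ := ha
  refine ⟨l.reverse, fun n => (t n)⁻¹, List.nodup_reverse.2 hl,
    fun n hn => h n _ (ht n (List.mem_reverse.1 hn)), ?_⟩
  rw [List.prod_inv_reverse, List.map_reverse, List.map_map]
  rfl

/-- The shift by `k` makes room for conjugators that grow by a word of length `k`. -/
theorem permProd_conj_mem {T T' : ℕ → Set G} (h : G) (k : ℕ)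
    (hT : ∀ n, ∀ g ∈ T' n, h * g * h⁻¹ ∈ T (n + k)) {a : G} (ha : a ∈ permProd T') :
    h * a * h⁻¹ ∈ permProd T := by
  obtain ⟨l, t, hl, ht, rfl⟩ := ha
  refine ⟨l.map (· + k), fun n => h * t (n - k) * h⁻¹, hl.map fun a b h => by simpa using h, ?_, ?_⟩
  · intro n hn
    obtain ⟨a, ha, rfl⟩ := List.mem_map.1 hn
    simpa using hT a _ (ht a ha)
  · rw [← MulAut.conj_apply, map_list_prod, List.map_map, List.map_map]
    simp [Function.comp_def]

/-- Split the list at its least index `m`. Both sides use only indices above `m`, so by induction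
they lie in `V (m + 1)`, as does `t m`; the triple product lies in `V m`. -/
theorem prod_mem_of_nodup {V : ℕ → Set G} (hV1 : ∀ n, (1 : G) ∈ V n)
    (hV : ∀ n, ∀ a ∈ V (n + 1), ∀ b ∈ V (n + 1), ∀ c ∈ V (n + 1), a * (b * c) ∈ V n) (t : ℕ → G)
    (N : ℕ) : ∀ l : List ℕ, l.length = N → l.Nodup → (∀ n ∈ l, t n ∈ V (n + 1)) →
      ∀ k, (∀ n ∈ l, k ≤ n) → (l.map t).prod ∈ V k := by
  have hanti : Antitone V := antitone_nat_of_succ_le fun n a ha => by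
    simpa using hV n a ha 1 (hV1 _) 1 (hV1 _)
  induction N using Nat.strong_induction_on with
  | _ N ih =>
    intro l hlN hl ht k hk
    by_cases hne : l = []
    · simpa [hne] using hV1 k
    obtain ⟨m, hm, hmin⟩ : ∃ m ∈ l, ∀ n ∈ l, m ≤ n := by
      obtain ⟨m, hm, h⟩ := l.toFinset.exists_min_image id
        (by simpa [List.toFinset_nonempty_iff] using hne)
      exact ⟨m, by simpa using hm, fun n hn => h n (by simpa using hn)⟩
    obtain ⟨a, b, rfl⟩ := List.append_of_mem hm
    have hl' := List.nodup_middle.1 hl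
    rw [List.nodup_cons] at hl'
    have hgt : ∀ n ∈ a ++ b, m + 1 ≤ n := fun n hn => by
      have h1 := hmin n (by simp at hn ⊢; tauto)
      have h2 : n ≠ m := fun h => hl'.1 (h ▸ hn)
      omega
    have ha := ih a.length (by simp at hlN; omega) a rfl (hl'.2.of_append_left)
      (fun n hn => ht n (by simp [hn])) (m + 1) (fun n hn => hgt n (by simp [hn]))
    have hb := ih b.length (by simp at hlN; omega) b rfl (hl'.2.of_append_right)
      (fun n hn => ht n (by simp [hn])) (m + 1) (fun n hn => hgt n (by simp [hn]))
    rw [List.map_append, List.map_cons, List.prod_append, List.prod_cons]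
    exact hanti (hk m hm) (hV m _ ha _ (ht m hm) _ hb)

theorem permProd_subset {V : ℕ → Set G} (hV1 : ∀ n, (1 : G) ∈ V n)
    (hV : ∀ n, ∀ a ∈ V (n + 1), ∀ b ∈ V (n + 1), ∀ c ∈ V (n + 1), a * (b * c) ∈ V n) :
    permProd (fun n => V (n + 1)) ⊆ V 0 := by
  rintro _ ⟨l, t, hl, ht, rfl⟩
  exact prod_mem_of_nodup hV1 hV t _ l rfl hl ht 0 fun _ _ => Nat.zero_le _

end permProd

theorem exists_seq_nhds_one {G : Type*} [Group G] [TopologicalSpace G] [IsTopologicalGroup G]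
    {U : Set G} (hU : U ∈ 𝓝 (1 : G)) : ∃ V : ℕ → Set G, V 0 = U ∧ (∀ n, V n ∈ 𝓝 (1 : G)) ∧
      ∀ n, ∀ a ∈ V (n + 1), ∀ b ∈ V (n + 1), ∀ c ∈ V (n + 1), a * (b * c) ∈ V n := by
  have key : ∀ W : {W : Set G // W ∈ 𝓝 (1 : G)}, ∃ W' : {W : Set G // W ∈ 𝓝 (1 : G)},
      ∀ a ∈ W'.1, ∀ b ∈ W'.1, ∀ c ∈ W'.1, a * (b * c) ∈ W.1 := by
    rintro ⟨W, hW⟩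
    obtain ⟨W', hW', h⟩ := exists_nhds_one_split4 hW
    exact ⟨⟨W', hW'⟩, fun a ha b hb c hc => by
      simpa [mul_assoc] using h ha hb hc (mem_of_mem_nhds hW')⟩
  choose s hs using key
  exact ⟨fun n => (s^[n] ⟨U, hU⟩).1, rfl, fun n => (s^[n] ⟨U, hU⟩).2, fun n => by
    simp only [Function.iterate_succ_apply']; exact hs _⟩

open Pointwise in
/-- Words of length at most `n` in the image of `i`. -/
def wordsLE {X G : Type*} [Group G] (i : X → G) (n : ℕ) : Set G :=
  ({1} ∪ Set.range i ∪ (Set.range i)⁻¹) ^ n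

section words

open Pointwise

variable {X G : Type*} [Group G] (i : X → G)

theorem one_mem_wordsLE (n : ℕ) : (1 : G) ∈ wordsLE i n :=
  Set.one_mem_pow (by simp)

theorem mul_mem_wordsLE {m n : ℕ} {a b : G} (ha : a ∈ wordsLE i m) (hb : b ∈ wordsLE i n) :
    a * b ∈ wordsLE i (m + n) := by
  rw [wordsLE, pow_add]
  exact Set.mul_mem_mul ha hb

theorem wordsLE_mono {m n : ℕ} (h : m ≤ n) : wordsLE i m ⊆ wordsLE i n :=
  Set.pow_subset_pow_right (by simp) h

theorem exists_mem_wordsLE (hi : Subgroup.closure (Set.range i) = ⊤) (g : G) :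
    ∃ n, g ∈ wordsLE i n := by
  have hg : g ∈ Submonoid.closure (Set.range i ∪ (Set.range i)⁻¹) := by
    rw [← Subgroup.closure_toSubmonoid, hi]
    exact Subgroup.mem_top g
  obtain ⟨l, hl, rfl⟩ := Submonoid.exists_list_of_mem_closure hg
  clear hg
  refine ⟨l.length, ?_⟩
  induction l with
  | nil => exact one_mem_wordsLE i 0
  | cons a l ih =>
    rw [List.prod_cons, List.length_cons, add_comm]
    refine mul_mem_wordsLE i ?_ (ih fun x hx => hl x (List.mem_cons_of_mem a hx))
    rw [wordsLE, pow_one]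
    rcases hl a List.mem_cons_self with h | h
    · exact Or.inl (Or.inr h)
    · exact Or.inr h

theorem isCompact_wordsLE [TopologicalSpace X] [CompactSpace X] [TopologicalSpace G]
    [IsTopologicalGroup G] (hi : Continuous i) (n : ℕ) : IsCompact (wordsLE i n) := by
  have hc : IsCompact ({1} ∪ Set.range i ∪ (Set.range i)⁻¹ : Set G) :=
    (isCompact_singleton.union (isCompact_range hi)).union (isCompact_range hi).inv
  induction n with
  | zero => simp [wordsLE]
  | succ n ih =>
    rw [wordsLE, pow_succ]
    exact ih.mul hc

end words

/-! ### A neighbourhood base at the identity. -/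

section conjDiff

variable {X G : Type*} [Group G] (i : X → G)

/-- The conjugates by elements of `K` of the elements `x y⁻¹` and `y x⁻¹` with `(x, y) ∈ E`. -/
def conjDiff (K : Set G) (E : Set (X × X)) : Set G :=
  {g | ∃ k ∈ K, ∃ x y, ((x, y) ∈ E ∨ (y, x) ∈ E) ∧ g = k * (i x * (i y)⁻¹) * k⁻¹}

theorem conjDiff_mono {K K' : Set G} {E E' : Set (X × X)} (hK : K ⊆ K') (hE : E ⊆ E') :
    conjDiff i K E ⊆ conjDiff i K' E' := by
  rintro _ ⟨k, hk, x, y, h, rfl⟩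
  exact ⟨k, hK hk, x, y, h.imp (@hE _) (@hE _), rfl⟩

theorem inv_mem_conjDiff {K : Set G} {E : Set (X × X)} {g : G} (hg : g ∈ conjDiff i K E) :
    g⁻¹ ∈ conjDiff i K E := by
  obtain ⟨k, hk, x, y, h, rfl⟩ := hg
  exact ⟨k, hk, y, x, h.symm, by group⟩

theorem conj_mem_conjDiff {K K' : Set G} {E : Set (X × X)} {h : G} (hK : ∀ k ∈ K, h * k ∈ K')
    {g : G} (hg : g ∈ conjDiff i K E) : h * g * h⁻¹ ∈ conjDiff i K' E := by
  obtain ⟨k, hk, x, y, hxy, rfl⟩ := hg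
  exact ⟨h * k, hK k hk, x, y, hxy, by group⟩

/-- On the diagonal the conjugates equal `1` for every `k`; compactness of `K` makes the estimate
near it uniform in `k`. -/
theorem exists_conjDiff_subset [TopologicalSpace X] [TopologicalSpace G] [IsTopologicalGroup G]
    (hi : Continuous i) {K : Set G} (hK : IsCompact K) {O : Set G} (hO : O ∈ 𝓝 (1 : G)) :
    ∃ D : Set (X × X), (∀ x, D ∈ 𝓝 (x, x)) ∧ conjDiff i K D ⊆ O := by
  let P : X × X → Prop := fun p => ∀ k ∈ K, k * (i p.1 * (i p.2)⁻¹) * k⁻¹ ∈ O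
  have hP : ∀ x, ∀ᶠ p in 𝓝 (x, x), P p := fun x => by
    refine hK.eventually_forall_of_forall_eventually fun k _ => ?_
    have hc : Continuous fun q : (X × X) × G => q.2 * (i q.1.1 * (i q.1.2)⁻¹) * q.2⁻¹ := by
      fun_prop
    exact hc.continuousAt.eventually_mem (by simpa using hO)
  refine ⟨{p | P p ∧ P p.swap}, fun x => ?_, ?_⟩
  · exact (hP x).and ((continuous_swap.tendsto (x, x)).eventually (hP x))
  · rintro _ ⟨k, hk, x, y, h | h, rfl⟩
    · exact h.1 k hk
    · exact h.2 k hk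

/-- The basic neighbourhood of the identity given by a sequence of entourages. -/
def basicNhd (E : ℕ → Set (X × X)) : Set G :=
  permProd fun n => conjDiff i (wordsLE i n) (E n)

theorem basicNhd_mono {E E' : ℕ → Set (X × X)} (h : ∀ n, E n ⊆ E' n) :
    basicNhd i E ⊆ basicNhd i E' :=
  permProd_mono fun n => conjDiff_mono i subset_rfl (h n)

variable [TopologicalSpace X]

/-- The filter basis at the identity consisting of the basic neighbourhoods. -/
@[reducible]
def basicNhdFilterBasis (hi : Subgroup.closure (Set.range i) = ⊤) : GroupFilterBasis G where
  sets := {W | ∃ E : ℕ → Set (X × X), (∀ n x, E n ∈ 𝓝 (x, x)) ∧ W = basicNhd i E}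
  nonempty := ⟨_, fun _ => Set.univ, fun _ _ => Filter.univ_mem, rfl⟩
  inter_sets := by
    rintro _ _ ⟨E, hE, rfl⟩ ⟨E', hE', rfl⟩
    exact ⟨_, ⟨fun n => E n ∩ E' n, fun n x => Filter.inter_mem (hE n x) (hE' n x), rfl⟩,
      Set.subset_inter (basicNhd_mono i fun _ => Set.inter_subset_left)
        (basicNhd_mono i fun _ => Set.inter_subset_right)⟩
  one' := by
    rintro _ ⟨E, hE, rfl⟩
    exact one_mem_permProd _
  mul' := by
    rintro _ ⟨E, hE, rfl⟩
    refine ⟨_, ⟨fun n => E (2 * n) ∩ E (2 * n + 1), fun n x =>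
      Filter.inter_mem (hE _ x) (hE _ x), rfl⟩, ?_⟩
    rintro _ ⟨a, ha, b, hb, rfl⟩
    exact permProd_mul_mem
      (fun n => conjDiff_mono i (wordsLE_mono i (by omega)) Set.inter_subset_left)
      (fun n => conjDiff_mono i (wordsLE_mono i (by omega)) Set.inter_subset_right) ha hb
  inv' := by
    rintro _ ⟨E, hE, rfl⟩
    exact ⟨_, ⟨E, hE, rfl⟩, fun a ha => permProd_inv_mem (fun n g => inv_mem_conjDiff i) ha⟩
  conj' := by
    rintro h _ ⟨E, hE, rfl⟩
    obtain ⟨k, hk⟩ := exists_mem_wordsLE i hi h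
    refine ⟨_, ⟨fun n => E (n + k), fun n => hE (n + k), rfl⟩, fun a ha => ?_⟩
    refine permProd_conj_mem h k (fun n g hg => conj_mem_conjDiff i (fun w hw => ?_) hg) ha
    rw [add_comm]
    exact mul_mem_wordsLE i hk hw

theorem IsFinestGroupTopology.basicNhd_mem_nhds [TopologicalSpace G] {i : X → G}
    (hi : IsFinestGroupTopology i) {E : ℕ → Set (X × X)} (hE : ∀ n x, E n ∈ 𝓝 (x, x)) :
    basicNhd i E ∈ 𝓝 (1 : G) := by
  let B := basicNhdFilterBasis i hi.closure_range
  have hle := hi.le B.topology B.isTopologicalGroup (by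
    rw [@continuous_iff_continuousAt _ _ _ B.topology]
    intro x
    refine ((B.nhds_hasBasis (i x)).tendsto_right_iff).2 ?_
    rintro _ hV
    -- Basic neighbourhoods of `i x` are left translates, while `conjDiff` supplies `i y * (i x)⁻¹`;
    -- a conjugation passes between them.
    obtain ⟨V', hV', hVV'⟩ := B.conj (i x)⁻¹ hV
    obtain ⟨F, hF, rfl⟩ := hV'
    filter_upwards [(Continuous.prodMk_left x).continuousAt.preimage_mem_nhds (hF 0 x)] with y hy
    refine ⟨(i x)⁻¹ * i y, ?_, by simp⟩
    have hmem : i y * (i x)⁻¹ ∈ basicNhd i F :=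
      subset_permProd _ 0 ⟨1, one_mem_wordsLE i 0, y, x, Or.inl hy, by simp⟩
    simpa [mul_assoc] using hVV' hmem)
  exact nhds_mono hle (B.mem_nhds_one ⟨E, hE, rfl⟩)

theorem exists_basicNhd_subset [CompactSpace X] [TopologicalSpace G] [IsTopologicalGroup G]
    {i : X → G} (hi : Continuous i) {U : Set G} (hU : U ∈ 𝓝 (1 : G)) :
    ∃ D : ℕ → Set (X × X), (∀ n x, D n ∈ 𝓝 (x, x)) ∧ basicNhd i D ⊆ U := by
  obtain ⟨V, rfl, hV, hmul⟩ := exists_seq_nhds_one hU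
  choose D hD hDV using fun n =>
    exists_conjDiff_subset i hi (isCompact_wordsLE i hi n) (hV (n + 1))
  exact ⟨D, hD, (permProd_mono hDV).trans
    (permProd_subset (fun n => mem_of_mem_nhds (hV n)) hmul)⟩

/-- If the entourages of `X` have an antitone base indexed by `Q`, then the neighbourhoods of the
identity have an antitone base indexed by sequences in `Q`. -/
theorem IsFinestGroupTopology.tukeyLE [CompactSpace X] [TopologicalSpace G]
    [IsTopologicalGroup G] {i : X → G} (hi : IsFinestGroupTopology i) {Q : Type*} [Preorder Q]
    (E : Q → Set (X × X)) (hanti : Antitone E) (hE : ∀ S x, E S ∈ 𝓝 (x, x))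
    (hcof : ∀ D : Set (X × X), (∀ x, D ∈ 𝓝 (x, x)) → ∃ S, E S ⊆ D) :
    TukeyLE (NhdsPoset G 1) (ℕ → Q) := by
  choose D hD hDU using fun U : NhdsPoset G 1 => exists_basicNhd_subset hi.continuous U.2
  choose S hS using fun (U : NhdsPoset G 1) (n : ℕ) => hcof (D U n) (hD U n)
  refine TukeyLE.of_galois S
    (fun F => OrderDual.toDual ⟨_, hi.basicNhd_mem_nhds fun n => hE (F n)⟩) fun U F hUF => ?_
  exact (basicNhd_mono i fun n => (hanti (hUF n)).trans (hS U n)).trans (hDU U)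

end conjDiff

/-! ### Entourages of a compact space and its weight. -/

/-- The set of pairs not separated by any of finitely many pairs of sets with disjoint closures. -/
def entourageOfPairs {X : Type*} [TopologicalSpace X] {κ : Type*} (s : κ → Set X × Set X)
    (S : Finset κ) : Set (X × X) :=
  {p | ∀ a ∈ S, Disjoint (closure (s a).1) (closure (s a).2) →
    ¬ (p.1 ∈ closure (s a).1 ∧ p.2 ∈ closure (s a).2)}

theorem entourageOfPairs_anti {X : Type*} [TopologicalSpace X] {κ : Type*}
    (s : κ → Set X × Set X) : Antitone (entourageOfPairs s) :=
  fun _ _ h _ hp a ha => hp a (h ha)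

theorem entourageOfPairs_mem_nhds {X : Type*} [TopologicalSpace X] {κ : Type*}
    (s : κ → Set X × Set X) (S : Finset κ) (x : X) : entourageOfPairs s S ∈ 𝓝 (x, x) := by
  have : entourageOfPairs s S = ⋂ a ∈ S, {p : X × X |
      Disjoint (closure (s a).1) (closure (s a).2) →
        ¬ (p.1 ∈ closure (s a).1 ∧ p.2 ∈ closure (s a).2)} := by
    ext p; simp [entourageOfPairs]
  rw [this]
  refine (Filter.biInter_finset_mem S).2 fun a _ => ?_
  by_cases h : Disjoint (closure (s a).1) (closure (s a).2)
  · have ho : IsOpen ((closure (s a).1 ×ˢ closure (s a).2)ᶜ : Set (X × X)) :=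
      (isClosed_closure.prod isClosed_closure).isOpen_compl
    refine Filter.mem_of_superset (ho.mem_nhds fun hx => ?_) fun p hp _ hp' => hp hp'
    exact Set.disjoint_left.1 h hx.1 hx.2
  · exact Filter.mem_of_superset Filter.univ_mem fun p _ h' => absurd h' h

/-- The compact complement of `interior D` misses the diagonal, so finitely many boxes of basic sets
with disjoint closures cover it. -/
theorem exists_entourageOfPairs_subset {X : Type*} [TopologicalSpace X] [CompactSpace X]
    [T2Space X] {B : Set (Set X)} (hB : TopologicalSpace.IsTopologicalBasis B) {κ : Type*}
    (s : κ → Set X × Set X) (hs : ∀ U ∈ B, ∀ V ∈ B, ∃ a, s a = (U, V)) (D : Set (X × X))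
    (hD : ∀ x, D ∈ 𝓝 (x, x)) : ∃ S, entourageOfPairs s S ⊆ D := by
  have hdiag : ∀ x, (x, x) ∈ interior D := fun x => mem_interior_iff_mem_nhds.2 (hD x)
  have hK : IsCompact (interior D)ᶜ := isOpen_interior.isClosed_compl.isCompact
  obtain ⟨t, ht⟩ := hK.elim_finite_subcover
    (fun a : {a : κ // (s a).1 ∈ B ∧ (s a).2 ∈ B ∧
      Disjoint (closure (s a).1) (closure (s a).2)} => (s a).1 ×ˢ (s a).2)
    (fun a => (hB.isOpen a.2.1).prod (hB.isOpen a.2.2.1)) (by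
      rintro ⟨x, y⟩ hxy
      have hne : x ≠ y := by rintro rfl; exact hxy (hdiag x)
      obtain ⟨U, hxU, hU, V, hyV, hV, hUV⟩ := exists_open_nhds_disjoint_closure hne
      obtain ⟨U', hU', hxU', hUU'⟩ := hB.exists_subset_of_mem_open hxU hU
      obtain ⟨V', hV', hyV', hVV'⟩ := hB.exists_subset_of_mem_open hyV hV
      obtain ⟨a, ha⟩ := hs U' hU' V' hV'
      refine Set.mem_iUnion.2 ⟨⟨a, ?_⟩, ?_⟩
      · rw [ha]
        exact ⟨hU', hV', hUV.mono (closure_mono hUU') (closure_mono hVV')⟩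
      · simp only [ha]
        exact ⟨hxU', hyV'⟩)
  classical
  refine ⟨t.image Subtype.val, fun p hp => ?_⟩
  by_contra hpD
  obtain ⟨a, ha, hpa⟩ := Set.mem_iUnion₂.1 (ht fun h => hpD (interior_subset h))
  exact hp a (Finset.mem_image_of_mem _ ha) a.2.2.2
    ⟨subset_closure hpa.1, subset_closure hpa.2⟩

theorem exists_basis_mk_eq_topWeight (X : Type u) [TopologicalSpace X] :
    ∃ B : Set (Set X), TopologicalSpace.IsTopologicalBasis B ∧ #B = topWeight X :=
  csInf_mem (s := {c | ∃ B : Set (Set X), TopologicalSpace.IsTopologicalBasis B ∧ #B = c})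
    ⟨_, _, TopologicalSpace.isTopologicalBasis_opens, rfl⟩

theorem infinite_of_isTopologicalBasis {X : Type u} [TopologicalSpace X] [T0Space X] [Infinite X]
    {B : Set (Set X)} (hB : TopologicalSpace.IsTopologicalBasis B) : Infinite B := by
  by_contra hfin
  rw [not_infinite_iff_finite] at hfin
  have hinj : Function.Injective fun x : X => {U : B | x ∈ U.1} := fun x y hxy => by
    refine (hB.inseparable_iff.2 fun U hU => ?_).eq
    exact Set.ext_iff.1 hxy ⟨U, hU⟩
  exact not_finite_iff_infinite.2 ‹Infinite X› (Finite.of_injective _ hinj)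

/-- A monotone family of entourages indexed by the finite subsets of the weight. -/
theorem exists_antitone_entourages (X : Type u) [TopologicalSpace X] [CompactSpace X] [T2Space X]
    [Infinite X] : ∃ E : Finset (topWeight X).out → Set (X × X), Antitone E ∧
      (∀ S x, E S ∈ 𝓝 (x, x)) ∧
      ∀ D : Set (X × X), (∀ x, D ∈ 𝓝 (x, x)) → ∃ S, E S ⊆ D := by
  obtain ⟨B, hB, hBc⟩ := exists_basis_mk_eq_topWeight X
  have := infinite_of_isTopologicalBasis hB
  have hcard : #(topWeight X).out = #(B × B) := by
    rw [mk_out, ← hBc, mk_prod, lift_id, mul_eq_self (aleph0_le_mk B)]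
  obtain ⟨e⟩ := Cardinal.eq.1 hcard
  let s : (topWeight X).out → Set X × Set X := fun a => ((e a).1.1, (e a).2.1)
  refine ⟨entourageOfPairs s, entourageOfPairs_anti s, entourageOfPairs_mem_nhds s,
    exists_entourageOfPairs_subset hB s fun U hU V hV => ⟨e.symm (⟨U, hU⟩, ⟨V, hV⟩), ?_⟩⟩
  simp [s]

/-- A separating family of continuous functions bounds the weight of a compact space. -/
theorem topWeight_le_of_separates {X : Type u} [TopologicalSpace X] [CompactSpace X]
    (S : Set C(X, ℝ)) [Infinite S] (hS : ∀ x y, x ≠ y → ∃ f ∈ S, f x ≠ f y) :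
    topWeight X ≤ #S := by
  let b : Finset (S × ℚ × ℚ) → Set X := fun F => ⋂ p ∈ F, p.1.1 ⁻¹' Set.Ioo (p.2.1 : ℝ) p.2.2
  have hb : TopologicalSpace.IsTopologicalBasis (Set.range b) := by
    refine TopologicalSpace.isTopologicalBasis_of_isOpen_of_nhds ?_ ?_
    · rintro _ ⟨F, rfl⟩
      exact isOpen_biInter_finset fun p _ => isOpen_Ioo.preimage p.1.1.continuous
    · intro x U hxU hU
      -- Each point of `Uᶜ` is excluded by some rational interval around a value `f x`; compactness
      -- leaves finitely many constraints.
      obtain ⟨t, ht⟩ := hU.isClosed_compl.isCompact.elim_finite_subcover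
        (fun p : {p : S × ℚ × ℚ // p.1.1 x ∈ Set.Ioo (p.2.1 : ℝ) p.2.2} =>
          p.1.1.1 ⁻¹' (Set.Icc (p.1.2.1 : ℝ) p.1.2.2)ᶜ)
        (fun p => isClosed_Icc.isOpen_compl.preimage p.1.1.1.continuous) (by
          intro y hy
          have hxy : x ≠ y := by rintro rfl; exact hy hxU
          obtain ⟨f, hf, hfxy⟩ := hS x y hxy
          rcases lt_or_gt_of_ne hfxy with h | h
          · obtain ⟨q, hq1, hq2⟩ := exists_rat_btwn h
            obtain ⟨r, hr⟩ := exists_rat_lt (f x)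
            refine Set.mem_iUnion.2 ⟨⟨⟨⟨f, hf⟩, r, q⟩, hr, hq1⟩, ?_⟩
            exact fun h' => absurd h'.2 (not_le.2 hq2)
          · obtain ⟨q, hq1, hq2⟩ := exists_rat_btwn h
            obtain ⟨r, hr⟩ := exists_rat_gt (f x)
            refine Set.mem_iUnion.2 ⟨⟨⟨⟨f, hf⟩, q, r⟩, hq2, hr⟩, ?_⟩
            exact fun h' => absurd h'.1 (not_le.2 hq1))
      classical
      refine ⟨_, ⟨t.image Subtype.val, rfl⟩, ?_, ?_⟩
      · simp only [b, Set.mem_iInter, Finset.mem_image]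
        rintro _ ⟨p, -, rfl⟩
        exact p.2
      · intro y hy
        by_contra hyU
        obtain ⟨p, hp, hyp⟩ := Set.mem_iUnion₂.1 (ht hyU)
        have := Set.mem_iInter₂.1 hy p.1 (Finset.mem_image_of_mem _ hp)
        exact hyp (Set.Ioo_subset_Icc_self this)
  calc topWeight X ≤ #(Set.range b) := csInf_le' ⟨_, hb, rfl⟩
    _ ≤ #(Finset (S × ℚ × ℚ)) := mk_range_le
    _ = #S := by
      rw [mk_finset_of_infinite, mk_prod, lift_uzero, mk_eq_aleph0 (ℚ × ℚ), lift_aleph0]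
      exact mul_aleph0_eq (aleph0_le_mk S)

/-! ### Separated families in `C(X, ℝ)`. -/

theorem not_finiteDimensional_continuousMap (X : Type u) [TopologicalSpace X] [CompactSpace X]
    [T2Space X] [Infinite X] : ¬ FiniteDimensional ℝ C(X, ℝ) := by
  intro hfin
  obtain ⟨s, hs⟩ := Infinite.exists_subset_card_eq X (Module.finrank ℝ C(X, ℝ) + 1)
  let T : C(X, ℝ) →ₗ[ℝ] (s → ℝ) :=
    { toFun := fun f x => f x
      map_add' := fun _ _ => rfl
      map_smul' := fun _ _ => rfl }
  have hT : Function.Surjective T := fun g => by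
    obtain ⟨f, hf⟩ := ContinuousMap.exists_restrict_eq (s := (s : Set X)) s.finite_toSet.isClosed
      (⟨g, by
        have : DiscreteTopology (s : Set X) := s.finite_toSet.instDiscreteTopology
        exact continuous_of_discreteTopology⟩ : C((s : Set X), ℝ))
    exact ⟨f, funext fun x => DFunLike.congr_fun hf x⟩
  have := LinearMap.finrank_le_finrank_of_surjective hT
  simp [hs] at this

/-- A bounded separated family of continuous functions indexed by the weight. -/
theorem exists_separated_continuousMap (X : Type u) [TopologicalSpace X] [CompactSpace X]
    [T2Space X] [Infinite X] : ∃ f : (topWeight X).out → C(X, ℝ), (∀ a, ‖f a‖ ≤ 1) ∧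
      ∀ a b, a ≠ b → 1 / 2 ≤ ‖f a - f b‖ := by
  obtain ⟨S, hS⟩ := zorn_subset
    {S : Set C(X, ℝ) | (∀ f ∈ S, ‖f‖ ≤ 1) ∧ S.Pairwise fun f g => 1 / 2 ≤ ‖f - g‖} (by
      intro c hc hchain
      refine ⟨⋃₀ c, ⟨?_, ?_⟩, fun s hs => Set.subset_sUnion_of_mem hs⟩
      · rintro f ⟨s, hs, hf⟩
        exact (hc hs).1 f hf
      · exact (Set.pairwise_sUnion hchain.directedOn).2 fun s hs => (hc hs).2)
  obtain ⟨hS1, hS2⟩ := hS.prop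
  -- Otherwise Riesz's lemma gives a unit vector at distance at least `1/2` from the closed span,
  -- contradicting maximality of `S`.
  have hdense : (Submodule.span ℝ S).topologicalClosure = ⊤ := by
    by_contra hne
    obtain ⟨x, -, hx⟩ := SetLike.exists_of_lt (lt_top_iff_ne_top.2 hne)
    obtain ⟨f, hf, hf1, hf2⟩ := riesz_lemma_of_lt_one (𝕜 := ℝ)
      (Submodule.isClosed_topologicalClosure (Submodule.span ℝ S)) ⟨x, hx⟩
      (show (1 / 2 : ℝ) < 1 by norm_num)
    have hSF : S ⊆ (Submodule.span ℝ S).topologicalClosure :=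
      Submodule.subset_span.trans (Submodule.le_topologicalClosure _)
    have : insert f S ⊆ S := hS.le_of_ge ⟨?_, ?_⟩ (Set.subset_insert f S)
    · exact hf (hSF (this (Set.mem_insert f S)))
    · rintro g (rfl | hg)
      · exact hf1.le
      · exact hS1 g hg
    · refine hS2.insert fun g hg _ => ⟨hf2 g (hSF hg), ?_⟩
      rw [norm_sub_rev]
      exact hf2 g (hSF hg)
  have hinf : Infinite S := by
    rw [Set.infinite_coe_iff]
    intro hfin
    have := FiniteDimensional.span_of_finite ℝ hfin
    rw [(Submodule.closed_of_finiteDimensional _).submodule_topologicalClosure_eq] at hdense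
    rw [hdense] at this
    exact not_finiteDimensional_continuousMap X (Module.finite_def.2 (Module.Finite.iff_fg.1 this))
  -- If all of `S` agreed at `x` and `y`, so would its closed span, which is everything; this
  -- contradicts Urysohn's lemma.
  have hsep : ∀ x y, x ≠ y → ∃ f ∈ S, f x ≠ f y := by
    intro x y hxy
    by_contra! h
    let e : C(X, ℝ) →L[ℝ] ℝ :=
      ContinuousMap.evalCLM ℝ x - ContinuousMap.evalCLM ℝ y
    have hle : (Submodule.span ℝ S).topologicalClosure ≤ LinearMap.ker e.toLinearMap := by
      refine Submodule.topologicalClosure_minimal _ (Submodule.span_le.2 fun f hf => ?_)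
        e.isClosed_ker
      simp [e, h f hf]
    obtain ⟨f, hf0, hf1, -⟩ := exists_continuous_zero_one_of_isClosed (isClosed_singleton (x := x))
      (isClosed_singleton (x := y)) (by simpa using hxy)
    have : f ∈ LinearMap.ker e.toLinearMap := hle (hdense ▸ Submodule.mem_top)
    simp [e, hf0 rfl, hf1 rfl] at this
  have hcard : #(topWeight X).out ≤ #S := by
    rw [mk_out]
    exact topWeight_le_of_separates S hsep
  obtain ⟨j⟩ := hcard
  exact ⟨fun a => (j a).1, fun a => hS1 _ (j a).2, fun a b hab =>
    hS2 (j a).2 (j b).2 fun h => hab (j.injective (Subtype.ext h))⟩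

/-! ### The lower bound. -/

section lower

variable {X : Type*} [TopologicalSpace X] {κ : Type*}

/-- The map `x ↦ (2⁻ⁿ f_α(x))`, indexed by the pairs `(n, α)` with `α ∈ F n`. -/
noncomputable def weightedEval (f : κ → C(X, ℝ)) (F : ℕ → Finset κ) (x : X) :
    (ℕ × κ) → ℝ := by
  classical exact fun p => if p.2 ∈ F p.1 then (2 ^ p.1)⁻¹ * f p.2 x else 0

theorem weightedEval_of_mem (f : κ → C(X, ℝ)) {F : ℕ → Finset κ} {n : ℕ} {a : κ} (h : a ∈ F n)
    (x : X) : weightedEval f F x (n, a) = (2 ^ n)⁻¹ * f a x := by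
  simp [weightedEval, h]

/-- The weights make the coordinates with large `n` uniformly small; finitely many functions remain.
-/
theorem continuous_weightedEval [CompactSpace X] {f : κ → C(X, ℝ)} (hf : ∀ a, ‖f a‖ ≤ 1)
    (F : ℕ → Finset κ) :
    Continuous fun x => UniformFun.ofFun (weightedEval f F x) := by
  rw [continuous_iff_continuousAt]
  intro x
  rw [ContinuousAt, UniformFun.tendsto_iff_tendstoUniformly, Metric.tendstoUniformly_iff]
  intro ε hε
  obtain ⟨N, hN⟩ := exists_pow_lt_of_lt_one (half_pos hε) (show (1 / 2 : ℝ) < 1 by norm_num)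
  have hev : ∀ᶠ y in 𝓝 x, ∀ n ∈ Finset.range N, ∀ a ∈ F n, dist (f a x) (f a y) < ε :=
    (Filter.eventually_all_finset _).2 fun n _ => (Filter.eventually_all_finset _).2 fun a _ => by
      have := (f a).continuous.tendsto x
      filter_upwards [this (Metric.ball_mem_nhds _ hε)] with y hy
      rw [dist_comm]
      exact hy
  filter_upwards [hev] with y hy
  rintro ⟨n, a⟩
  change dist (weightedEval f F x (n, a)) (weightedEval f F y (n, a)) < ε
  by_cases ha : a ∈ F n
  · rw [weightedEval_of_mem f ha, weightedEval_of_mem f ha, Real.dist_eq, ← mul_sub, abs_mul,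
      abs_of_pos (by positivity), ← Real.dist_eq]
    by_cases hn : n < N
    · calc (2 ^ n)⁻¹ * dist (f a x) (f a y) ≤ 1 * dist (f a x) (f a y) := by
            gcongr
            exact inv_le_one_of_one_le₀ (one_le_pow₀ (by norm_num))
        _ < ε := by rw [one_mul]; exact hy n (Finset.mem_range.2 hn) a ha
    · have h2 : dist (f a x) (f a y) ≤ 2 := by
        have h3 := ((f a).norm_coe_le_norm x).trans (hf a)
        have h4 := ((f a).norm_coe_le_norm y).trans (hf a)
        rw [dist_eq_norm]
        linarith [norm_sub_le (f a x) (f a y)]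
      have h5 : ((2 : ℝ) ^ n)⁻¹ ≤ (1 / 2) ^ N := by
        rw [← inv_pow, ← one_div]
        exact pow_le_pow_of_le_one (by norm_num) (by norm_num) (not_lt.1 hn)
      calc (2 ^ n)⁻¹ * dist (f a x) (f a y) ≤ (1 / 2) ^ N * 2 := by gcongr
        _ < ε := by linarith
  · simpa [weightedEval, ha] using hε

/-- Finitely many slices of `D` cover `X`. If `8 * f a` and `8 * f b` have equal floors at the
centres, the functions differ by at most `1/8` there, hence by at most `1/8 + 2/16 = 1/4 < 1/2`
everywhere. -/
theorem finite_setOf_close [CompactSpace X] {f : κ → C(X, ℝ)} (hf : ∀ a, ‖f a‖ ≤ 1)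
    (hsep : ∀ a b, a ≠ b → 1 / 2 ≤ ‖f a - f b‖) {D : Set (X × X)} (hD : ∀ x, D ∈ 𝓝 (x, x)) :
    {a | ∀ x y, (x, y) ∈ D → |f a x - f a y| ≤ 1 / 16}.Finite := by
  obtain ⟨t, ht⟩ := CompactSpace.elim_nhds_subcover (fun x => {y | (x, y) ∈ D}) fun x =>
    (Continuous.prodMk_right x).continuousAt.preimage_mem_nhds (hD x)
  let A := {a | ∀ x y, (x, y) ∈ D → |f a x - f a y| ≤ 1 / 16}
  have hbound : ∀ a x, |f a x| ≤ 1 := fun a x => ((f a).norm_coe_le_norm x).trans (hf a)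
  let r : A → t → Set.Icc (-8 : ℤ) 8 := fun a x => ⟨⌊8 * f a x⌋, by
    have := abs_le.1 (hbound a x)
    constructor
    · exact Int.le_floor.2 (by push_cast; linarith)
    · exact Int.cast_le.1 ((Int.floor_le _).trans (by push_cast; linarith) : (_ : ℝ) ≤ _)⟩
  have hr : Function.Injective r := fun a b hab => by
    by_contra hne
    refine absurd (hsep a b fun h => hne (Subtype.ext h)) (not_le.2 ?_)
    refine lt_of_le_of_lt ((ContinuousMap.norm_le _ (show (0 : ℝ) ≤ 1 / 4 by norm_num)).2 ?_)
      (by norm_num)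
    intro y
    have hy : y ∈ ⋃ x ∈ t, {y | (x, y) ∈ D} := ht ▸ Set.mem_univ y
    obtain ⟨x, hx, hxy⟩ := Set.mem_iUnion₂.1 hy
    have h1 := abs_le.1 (a.2 x y hxy)
    have h2 := abs_le.1 (b.2 x y hxy)
    have h3 : ⌊8 * f a x⌋ = ⌊8 * f b x⌋ := congrArg Subtype.val (congrFun hab ⟨x, hx⟩)
    have h4 := abs_lt.1 (Int.abs_sub_lt_one_of_floor_eq_floor h3)
    rw [ContinuousMap.sub_apply, Real.norm_eq_abs, abs_le]
    constructor <;> linarith [h1.1, h1.2, h2.1, h2.2, h4.1, h4.2]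
  exact Set.finite_coe_iff.1 (Finite.of_injective r hr)

/-- Lower bound for the neighbourhoods of the identity in a group whose homomorphisms into
commutative groups are determined freely on `X`. -/
theorem IsFinestGroupTopology.tukeyLE_nhds [CompactSpace X] {G : Type*} [Group G]
    [TopologicalSpace G] [IsTopologicalGroup G] {i : X → G} (hi : IsFinestGroupTopology i)
    (hlift : ∀ h : X → Multiplicative (UniformFun (ℕ × κ) ℝ),
      ∃ φ : G →* Multiplicative (UniformFun (ℕ × κ) ℝ), ∀ x, φ (i x) = h x)
    {f : κ → C(X, ℝ)} (hf : ∀ a, ‖f a‖ ≤ 1) (hsep : ∀ a b, a ≠ b → 1 / 2 ≤ ‖f a - f b‖) :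
    TukeyLE (ℕ → Finset κ) (NhdsPoset G 1) := by
  choose φ hφ using fun F : ℕ → Finset κ =>
    hlift fun x => Multiplicative.ofAdd (UniformFun.ofFun (weightedEval f F x))
  have hcont : ∀ F, Continuous (φ F) := fun F => hi.continuous_hom _ <| by
    have : φ F ∘ i = fun x => Multiplicative.ofAdd (UniformFun.ofFun (weightedEval f F x)) :=
      funext (hφ F)
    rw [this]
    exact continuous_ofAdd.comp (continuous_weightedEval hf F)
  let O (F : ℕ → Finset κ) : Set G := {g | ∀ p, |UniformFun.toFun (φ F g).toAdd p| < 1}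
  have hO : ∀ F, O F ∈ 𝓝 (1 : G) := fun F => by
    have h := (continuous_toAdd.comp (hcont F)).tendsto 1
    rw [UniformFun.tendsto_iff_tendstoUniformly, Metric.tendstoUniformly_iff] at h
    filter_upwards [h 1 one_pos] with g hg p
    have := hg p
    simp only [Function.comp_apply, map_one, toAdd_one] at this
    rw [dist_comm] at this
    simpa [Real.dist_eq] using this
  -- In the exponent, `2 ^ n` cancels the weight and `16` turns the bound `1` defining `O F` into
  -- `1/16`.
  have hfin (V : NhdsPoset G 1) (n : ℕ) : {a | ∀ x y,
      (i x * (i y)⁻¹) ^ (16 * 2 ^ n) ∈ (OrderDual.ofDual V).1 → |f a x - f a y| ≤ 1 / 16}.Finite := by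
    refine finite_setOf_close (D := {p | (i p.1 * (i p.2)⁻¹) ^ (16 * 2 ^ n) ∈ (OrderDual.ofDual V).1})
      hf hsep
      fun x => ?_
    have hc : Continuous fun p : X × X => (i p.1 * (i p.2)⁻¹) ^ (16 * 2 ^ n) := by
      have := hi.continuous
      fun_prop
    exact hc.continuousAt.preimage_mem_nhds (by simpa using (OrderDual.ofDual V).2)
  refine TukeyLE.of_galois (fun F => OrderDual.toDual ⟨O F, hO F⟩)
    (fun V n => (hfin V n).toFinset) fun F V hFV n a ha => ?_
  rw [Set.Finite.mem_toFinset]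
  intro x y hxy
  have hmem : (i x * (i y)⁻¹) ^ (16 * 2 ^ n) ∈ O F := hFV hxy
  have h1 := hmem (n, a)
  have h2 : UniformFun.toFun (φ F ((i x * (i y)⁻¹) ^ (16 * 2 ^ n))).toAdd (n, a) =
      16 * (f a x - f a y) := by
    rw [map_pow, map_mul, map_inv, hφ, hφ, ← ofAdd_neg, ← ofAdd_add, ← ofAdd_nsmul, toAdd_ofAdd]
    change (16 * 2 ^ n) • (weightedEval f F x (n, a) + -weightedEval f F y (n, a)) = _
    rw [weightedEval_of_mem f ha, weightedEval_of_mem f ha, nsmul_eq_mul]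
    push_cast
    field_simp
    ring
  rw [h2, abs_mul, abs_of_pos (by norm_num : (0 : ℝ) < 16)] at h1
  linarith

end lower

theorem FreeTopGroup.exists_hom {X : Type u} {H : Type*} [Group H] (h : X → H) :
    ∃ φ : FreeTopGroup X →* H, ∀ x, φ (FreeTopGroup.of x) = h x :=
  ⟨(FreeGroup.lift h : FreeGroup X →* H), fun _ => FreeGroup.lift_apply_of⟩

theorem FreeAbTopGroup.exists_hom {X : Type u} {H : Type*} [AddCommGroup H]
    (h : X → Multiplicative H) :
    ∃ φ : Multiplicative (FreeAbTopGroup X) →* Multiplicative H,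
      ∀ x, φ (FreeAbTopGroup.mulOf x) = h x :=
  ⟨AddMonoidHom.toMultiplicative
    (FreeAbelianGroup.lift fun x => (h x).toAdd : FreeAbelianGroup X →+ H),
    fun x => congrArg Multiplicative.ofAdd (FreeAbelianGroup.lift_apply_of (fun x => (h x).toAdd) x)⟩

theorem mainTheorem3 (X : Type u) [TopologicalSpace X] [CompactSpace X] [T2Space X] [Infinite X]
    (τ : Cardinal.{u}) (hτ : topWeight X = τ) :
    TukeyEquiv (NhdsPoset (FreeTopGroup X) 1) (NhdsPoset (FreeAbTopGroup X) 0) ∧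
      TukeyEquiv (NhdsPoset (FreeAbTopGroup X) 0) (ℕ → Finset τ.out) := by
  subst hτ
  obtain ⟨E, hanti, hE, hcof⟩ := exists_antitone_entourages X
  obtain ⟨f, hf, hsep⟩ := exists_separated_continuousMap X
  have hF := FreeTopGroup.isFinestGroupTopology X
  have hA := FreeAbTopGroup.isFinestGroupTopology X
  have hF₁ := hF.tukeyLE E hanti hE hcof
  have hF₂ := hF.tukeyLE_nhds FreeTopGroup.exists_hom hf hsep
  -- The neighbourhoods of `1` in `Multiplicative (FreeAbTopGroup X)` are by definition those of `0`
  -- in `FreeAbTopGroup X`.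
  have hA₁ : TukeyLE (NhdsPoset (FreeAbTopGroup X) 0) (ℕ → Finset (topWeight X).out) :=
    hA.tukeyLE E hanti hE hcof
  have hA₂ : TukeyLE (ℕ → Finset (topWeight X).out) (NhdsPoset (FreeAbTopGroup X) 0) :=
    hA.tukeyLE_nhds FreeAbTopGroup.exists_hom hf hsep
  exact ⟨⟨hF₁.trans hA₂, hA₁.trans hF₂⟩, hA₁, hA₂⟩
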